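/- **Theorem (Soundness of the CSL).** *States.* An IDF algebra is a set with a partial, commutative, associative addition $\oplus$, maps $|\cdot|$ (core), $\mathsf{stabilize}$, $\mathsf{unit}$ and a predicate $\mathsf{stable}$ such that (equations with $\oplus$ on the left of $\Rightarrow$ presuppose that the sum is defined, and a sum asserted on the right is asserted to be defined): $c=a\oplus b\wedge c=c\oplus c\Rightarrow a=a\oplus a$; $x=x\oplus|x|$; $|x|=|x|\oplus|x|$; $x=x\oplus c\Rightarrow|x|\succeq c$; $c=a\oplus b\Rightarrow|c|=|a|\oplus|b|$; $a=b\oplus x=b\oplus y\wedge|x|=|y|\Rightarrow x=y$; $\mathsf{stable}(x)\Rightarrow x=\mathsf{stabilize}(x)$; $\mathsf{stable}(\mathsf{stabilize}(x))$; $c=a\oplus b\Rightarrow\mathsf{stabilize}(c)=\mathsf{stabilize}(a)\oplus\mathsf{stabilize}(b)$; $x=\mathsf{stabilize}(x)\oplus|x|$; $a=b\oplus\mathsf{unit}(c)\Rightarrow a=b$; $a=a\oplus\mathsf{unit}(a)$; $|\mathsf{unit}(a)|=\mathsf{unit}(a)$; $\mathsf{stable}(\mathsf{unit}(a))$. Here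 $\omega'\succeq\omega$ means $\exists r.\ \omega'=\omega\oplus r$. Fix sets of variables $\mathsf{Var}$, types $T$, values $V$ with $\mathsf{ty}:V\to T$, an IDF algebra $H_F$ of ghost heaps, a set $H_P$ of program heaps, and $\mathsf{emb}:H_P\to H_F$. Ghost states are $\Sigma_F=(\mathsf{Var}\rightharpoonup V)\times H_F$, with $(s_1,h_1)\oplus(s_2,h_2)$ defined iff $s_1=s_2$ and $h_1\oplus h_2$ is defined, and then equal to $(s_1,h_1\oplus h_2)$; the other operations act on the heap. Program states are $\Sigma_P=(\mathsf{Var}\rightharpoonup V)\times H_P$, and $\mathsf{emb}(s,h)=(s,\mathsf{emb}(h))$. A program state is called stable if its embedding is. Assertions are sets $P\subseteq\Sigma_F$; $P*Q=\{\omega_1\oplus\omega_2\mid\omega_1\in P,\omega_2\in Q\}$; $P$ is self-framing iff $\omega\in P\Leftrightarrow\mathsf{stabilize}(\omega)\in P$ for all $\omega$; $P$ is monotone iff it is upward closed under $\succeq$; $\uparrow P$ is the least monotone assertion containing $P$; $P$ is independent of $x$ iff $\omega\in P\Leftrightarrow\omega[v/x]\in P$ for all $\omega\in\Sigma_F$,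 $v\in V$. Fix a type context $\Delta$, consisting of a partial map $\mathsf{Var}\rightharpoonup T$ and of typing information for heaps, which determines the well-typed program heaps. A program state $(s,h)$ is well-typed iff $h$ is well-typed, $\mathrm{dom}(s)=\mathrm{dom}(\Delta)$ and $\mathsf{ty}(s(x))=\Delta(x)$ for all $x$ in it. *Language.* Given are boolean expressions $b$ with partial interpretations $[\![b]\!]:\Sigma_F\rightharpoonup\{\mathsf{true},\mathsf{false}\}$, input assertions $A_p$ with $[\![A_p]\!]\subseteq\Sigma_F$, and primitive statements $C_p$ with a well-formedness predicate, a reduction relation $\sigma\xrightarrow{C_p}\sigma'$ on $\Sigma_P$ and a set of primitive triples $\vdash_p\{P\}\,C_p\,\{Q\}$; boolean expressions, input assertions and primitive statements have finite free-variable sets $\mathsf{fv}$, and primitive statements finite modified-variable sets $\mathsf{wr}$. Assertions are $A::=A_p\mid b\mid A*A\mid A\vee A\mid b\Rightarrow A\mid\exists x{:}t.\,A$, interpreted as usual (in particular $b\Rightarrow A$ requires $[\![b]\!]$ to be defined, and $\exists x{:}t.\,A$ holds in $\omega$ iff $A$ holds in $\omega[v/x]$ for some $v$ of type $t$). Statements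 are $C::=\mathsf{skip}\mid C_p\mid C;C\mid\mathsf{if}\,b\,C\,C\mid\mathsf{while}\,b\,[I]\,C\mid\{A_1\}C_1\{B_1\}\parallel\{A_2\}C_2\{B_2\}$. $\mathsf{fv}$ (ignoring annotations of statements) and $\mathsf{wr}$ extend as usual. $C$ is well-formed iff all its primitive statements are; for each of its loops $I$ is self-framing and, on $I$, $b$ has the same value (or is undefined) before and after $\mathsf{stabilize}$; and for each of its parallel compositions $A_1,B_1,A_2,B_2$ are self-framing, $\mathsf{wr}(C_1)\cap(\mathsf{fv}(C_2)\cup\mathsf{fv}(A_2)\cup\mathsf{fv}(B_2))=\varnothing$ and $\mathsf{wr}(C_2)\cap(\mathsf{fv}(C_1)\cup\mathsf{fv}(A_1)\cup\mathsf{fv}(B_1))=\varnothing$. *Small-step semantics.* $\to$ is the least relation on configurations with: $(C_p,\sigma)\to(\mathsf{skip},\sigma')$ if $\sigma\xrightarrow{C_p}\sigma'$; $(\mathsf{skip};C,\sigma)\to(C,\sigma)$; $(C_1;C_2,\sigma)\to(C_1';C_2,\sigma')$ if $(C_1,\sigma)\to(C_1',\sigma')$; $(\mathsf{if}\,b\,C_1\,C_2,\sigma)\to(C_1,\sigma)$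 resp. $(C_2,\sigma)$ if $[\![b]\!](\mathsf{emb}(\sigma))$ is $\mathsf{true}$ resp. $\mathsf{false}$; $(\mathsf{while}\,b\,[I]\,C,\sigma)\to(\mathsf{if}\,b\,(C;\mathsf{while}\,b\,[I]\,C)\,\mathsf{skip},\sigma)$; a parallel composition steps by a step of either branch, and to $\mathsf{skip}$ if both branches are $\mathsf{skip}$. A configuration aborts if it is $(C_p,\sigma)$ without any $\sigma'$ such that $\sigma\xrightarrow{C_p}\sigma'$; or $(\mathsf{if}\,b\,C_1\,C_2,\sigma)$ with $[\![b]\!](\mathsf{emb}(\sigma))$ undefined; or $(C_1;C_2,\sigma)$ where $(C_1,\sigma)$ aborts; or a parallel composition one of whose branches aborts in $\sigma$. (Every stuck configuration other than $(\mathsf{skip},\sigma)$ aborts.) Executing $C$ from $\sigma$ never aborts if no configuration reachable from $(C,\sigma)$ aborts. *CSL.* $\vdash\{P\}\,C\,\{Q\}$ is generated by the following rules. - Skip: $\vdash\{P\}\,\mathsf{skip}\,\{P\}$ for self-framing $P$. - Primitive: $\vdash\{P\}\,C_p\,\{Q\}$ if $\vdash_p\{P\}\,C_p\,\{Q\}$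 and $P,Q$ are self-framing. - Sequence: from $\vdash\{P\}C_1\{R\}$ and $\vdash\{R\}C_2\{Q\}$ infer $\vdash\{P\}\,C_1;C_2\,\{Q\}$. - Conditional: if $[\![b]\!]$ is defined on $P$, from $\vdash\{P\cap b\}C_1\{Q_1\}$ and $\vdash\{P\cap\neg b\}C_2\{Q_2\}$ infer $\vdash\{P\}\,\mathsf{if}\,b\,C_1\,C_2\,\{Q_1\cup Q_2\}$. - Loop: if $[\![b]\!]$ is defined on $P$ and, on $P$, has the same value (or is undefined) before and after $\mathsf{stabilize}$, from $\vdash\{P\cap b\}C\{P\}$ infer $\vdash\{P\}\,\mathsf{while}\,b\,[I]\,C\,\{P\cap\neg b\}$. - Parallel: from $\vdash\{P_i\}C_i\{Q_i\}$ ($i=1,2$), $\mathsf{fv}(C_1)\cap\mathsf{wr}(C_2)=\varnothing=\mathsf{fv}(C_2)\cap\mathsf{wr}(C_1)$, $P_1,Q_1$ independent of all $x\in\mathsf{wr}(C_2)$ and $P_2,Q_2$ independent of all $x\in\mathsf{wr}(C_1)$, infer $\vdash\{P_1*P_2\}\ \{A_1\}C_1\{B_1\}\parallel\{A_2\}C_2\{B_2\}\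 \{Q_1*Q_2\}$. - Frame: from $\vdash\{P\}C\{Q\}$ infer $\vdash\{P*R\}C\{Q*R\}$ for self-framing $R$ independent of all $x\in\mathsf{wr}(C)$. - Consequence: from $\vdash\{P\}C\{Q\}$ infer $\vdash\{P'\}C\{Q'\}$ for self-framing $P'\subseteq P$ and $Q'\supseteq Q$. *Requirements.* Assume: 1. $[\![b]\!](\omega)=[\![b]\!](|\omega|)$ (both undefined or both defined and equal), and if $[\![b]\!](\omega)$ is defined and $\omega'\succeq\omega$, then $[\![b]\!](\omega')=[\![b]\!](\omega)$. 2. $[\![b]\!](\omega)=[\![b]\!](\omega[v/x])$ (in the same sense) for $x\notin\mathsf{fv}(b)$ and $v\in V$; and $\omega\in[\![A_p]\!]\Leftrightarrow\omega[v/x]\in[\![A_p]\!]$ for $x\notin\mathsf{fv}(A_p)$ and $v$ of type $\Delta(x)$. 3. $\mathsf{wr}(C_p)\subseteq\mathrm{dom}(\Delta)$ for well-formed $C_p$. 4. If $\vdash_p\{P\}C_p\{Q\}$, then $\vdash_p\{\uparrow P\}C_p\{\uparrow Q\}$. 5. If $\sigma\xrightarrow{C_p}\sigma'$, then $\sigma$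 and $\sigma'$ agree on all variables outside $\mathsf{wr}(C_p)$; and if moreover $C_p$ is well-formed and $\sigma$ well-typed, then $\sigma'$ is well-typed. 6. If $X\supseteq\mathsf{fv}(C_p)$ has finite complement, $\sigma_1,\sigma_2$ agree on $X$ and on the heap, and $\sigma_1\xrightarrow{C_p}\sigma_1'$, then $\sigma_2\xrightarrow{C_p}\sigma_2'$ for some $\sigma_2'$ that agrees with $\sigma_1'$ on $X$ and on the heap. 7. Let $\vdash_p\{P\}C_p\{Q\}$ with $C_p$ well-formed and $P$ monotone, and let $\sigma$ be well-typed with $\mathsf{emb}(\sigma)=\omega\oplus\omega_f$, $\omega\in P$, and $\omega,\omega_f$ stable. Then $\sigma\xrightarrow{C_p}\sigma'$ for some $\sigma'$. If moreover $Q$ is monotone, then for every $\sigma'$ with $\sigma\xrightarrow{C_p}\sigma'$ there are a stable $\omega'\in Q$ and an $\omega_f'$ with the same heap as $\omega_f$ such that $\mathsf{emb}(\sigma')=\omega'\oplus\omega_f'$. *Claim.* If $\vdash\{P\}\,C\,\{Q\}$ with $C$ well-formed and $P$, $Q$ monotone, then for every well-typed stable program state $\sigma$ with $\mathsf{emb}(\sigma)\in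 P$, executing $C$ from $\sigma$ never aborts, and $\mathsf{emb}(\sigma')\in Q$ for every $\sigma'$ with $(C,\sigma)\to^*(\mathsf{skip},\sigma')$. -/

import Mathlib

universe uX uT uV uG uP uB uA uC uD

namespace FrontEndCSL

/-- An IDF algebra: a carrier with a partial, commutative and associative addition
(`none` means undefined), a core, a stability predicate, a stabilization and units. Equations
between possibly undefined sums are Kleene equations for commutativity and associativity; the
homomorphism laws for `core` and `stabilize` apply to sums that are defined. -/
class IDFAlgebra (S : Type*) where
  oplus : S → S → Option S
  core : S → S
  stable : S → Prop
  stabilize : S → S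
  unit : S → S
  oplus_comm : ∀ a b, oplus a b = oplus b a
  oplus_assoc : ∀ a b c, (oplus b c).bind (fun d => oplus a d) = (oplus a b).bind (fun d => oplus d c)
  positivity : ∀ a b c, oplus a b = some c → oplus c c = some c → oplus a a = some a
  oplus_core : ∀ x, oplus x (core x) = some x
  core_dup : ∀ x, oplus (core x) (core x) = some (core x)
  core_max : ∀ x c, oplus x c = some x → ∃ r, oplus c r = some (core x)
  core_oplus : ∀ a b c, oplus a b = some c → oplus (core a) (core b) = some (core c)
  cancel : ∀ a b x y, oplus b x = some a → oplus b y = some a → core x = core y → x = y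
  stable_eq : ∀ x, stable x → x = stabilize x
  stable_stabilize : ∀ x, stable (stabilize x)
  stabilize_oplus : ∀ a b c, oplus a b = some c →
    oplus (stabilize a) (stabilize b) = some (stabilize c)
  stabilize_core : ∀ x, oplus (stabilize x) (core x) = some x
  unit_neutral : ∀ a b c, oplus b (unit c) = some a → a = b
  oplus_unit : ∀ a, oplus a (unit a) = some a
  core_unit : ∀ a, core (unit a) = unit a
  stable_unit : ∀ a, stable (unit a)

section Assertions

variable {S : Type*} [IDFAlgebra S]

/-- `Ge a b` is `a ⪰ b`: `a` is `b` plus something. -/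
def Ge (a b : S) : Prop := ∃ r, IDFAlgebra.oplus b r = some a

/-- Separating conjunction of semantic assertions. -/
def sepConj (P Q : Set S) : Set S :=
  {w | ∃ w₁ ∈ P, ∃ w₂ ∈ Q, IDFAlgebra.oplus w₁ w₂ = some w}

def SelfFraming (P : Set S) : Prop := ∀ w, w ∈ P ↔ IDFAlgebra.stabilize w ∈ P

def Monotone (P : Set S) : Prop := ∀ w ∈ P, ∀ w', Ge w' w → w' ∈ P

/-- The least monotone assertion containing `P`. -/
def monotonize (P : Set S) : Set S := {w | ∃ w₀, Ge w w₀ ∧ w₀ ∈ P}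

/-- `P` frames the partial boolean expression `e`. -/
def Frames (P : Set S) (e : S → Option Bool) : Prop := ∀ w ∈ P, (e w).isSome

/-- `e` is stable under `P`: on `P`, `e` has the same value (or is undefined) before and after
stabilization. -/
def StableUnder (e : S → Option Bool) (P : Set S) : Prop :=
  ∀ w ∈ P, e w = e (IDFAlgebra.stabilize w)

end Assertions

/-! ### States -/

/-- Ghost states: a partial store of local variables and a ghost heap. -/
@[ext] structure GhostState (Var : Type uX) (V : Type uV) (HF : Type uG) where
  store : Var → Option V
  heap : HF

/-- Program states: a partial store of local variables and a program heap. -/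
@[ext] structure ProgState (Var : Type uX) (V : Type uV) (HP : Type uP) where
  store : Var → Option V
  heap : HP

/-- `w.upd x v` overwrites the local variable `x` with the value `v`. -/
def GhostState.upd {Var : Type uX} {V : Type uV} {HF : Type uG} [DecidableEq Var]
    (w : GhostState Var V HF) (x : Var) (v : V) : GhostState Var V HF :=
  ⟨Function.update w.store x (some v), w.heap⟩

open Classical in
/-- Addition of ghost states: stores have to agree, heaps are added. -/
noncomputable def GhostState.oplus {Var : Type uX} {V : Type uV} {HF : Type uG} [IDFAlgebra HF]
    (a b : GhostState Var V HF) : Option (GhostState Var V HF) :=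
  if a.store = b.store then
    (IDFAlgebra.oplus a.heap b.heap).map (fun h => ⟨a.store, h⟩)
  else none

theorem GhostState.oplus_eq_some {Var : Type uX} {V : Type uV} {HF : Type uG} [IDFAlgebra HF]
    (a b c : GhostState Var V HF) :
    GhostState.oplus a b = some c ↔
      a.store = c.store ∧ b.store = c.store ∧ IDFAlgebra.oplus a.heap b.heap = some c.heap := by
  obtain ⟨sa, ha⟩ := a
  obtain ⟨sb, hb⟩ := b
  obtain ⟨sc, hc⟩ := c
  unfold GhostState.oplus
  by_cases h : sa = sb
  · subst h
    simp only [if_true, Option.map_eq_some_iff, GhostState.mk.injEq]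
    constructor
    · rintro ⟨d, hd, rfl, rfl⟩
      exact ⟨rfl, rfl, hd⟩
    · rintro ⟨rfl, -, hd⟩
      exact ⟨hc, hd, rfl, rfl⟩
  · simp only [h, if_false]
    constructor
    · intro hh
      cases hh
    · rintro ⟨h1, h2, -⟩
      exact absurd (h1.trans h2.symm) h

/-- Ghost states form an IDF algebra: the product of the agreement algebra on stores (where
core, stabilization and unit are the identity and everything is stable) with the ghost heaps. -/
noncomputable instance GhostState.instIDFAlgebra {Var : Type uX} {V : Type uV} {HF : Type uG}
    [IDFAlgebra HF] : IDFAlgebra (GhostState Var V HF) where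
  oplus := GhostState.oplus
  core w := ⟨w.store, IDFAlgebra.core w.heap⟩
  stable w := IDFAlgebra.stable w.heap
  stabilize w := ⟨w.store, IDFAlgebra.stabilize w.heap⟩
  unit w := ⟨w.store, IDFAlgebra.unit w.heap⟩
  oplus_comm a b := by
    apply Option.ext
    intro c
    rw [GhostState.oplus_eq_some, GhostState.oplus_eq_some, IDFAlgebra.oplus_comm]
    tauto
  oplus_assoc a b c := by
    apply Option.ext
    intro e
    have key := IDFAlgebra.oplus_assoc a.heap b.heap c.heap
    have key' := congrArg (fun o => o = some e.heap) key
    simp only [Option.bind_eq_some_iff, eq_iff_iff] at key'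
    simp only [Option.bind_eq_some_iff, GhostState.oplus_eq_some]
    constructor
    · rintro ⟨d, ⟨h1, h2, h3⟩, h4, h5, h6⟩
      obtain ⟨f, hf1, hf2⟩ := key'.1 ⟨d.heap, h3, h6⟩
      exact ⟨⟨e.store, f⟩, ⟨h4, h1.trans h5, hf1⟩, rfl, h2.trans h5, hf2⟩
    · rintro ⟨d, ⟨h1, h2, h3⟩, h4, h5, h6⟩
      obtain ⟨f, hf1, hf2⟩ := key'.2 ⟨d.heap, h3, h6⟩
      exact ⟨⟨e.store, f⟩, ⟨h2.trans h4, h5, hf1⟩, h1.trans h4, rfl, hf2⟩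
  positivity a b c := by
    rw [GhostState.oplus_eq_some, GhostState.oplus_eq_some, GhostState.oplus_eq_some]
    rintro ⟨-, -, h⟩ ⟨-, -, h'⟩
    exact ⟨rfl, rfl, IDFAlgebra.positivity _ _ _ h h'⟩
  oplus_core x := (GhostState.oplus_eq_some _ _ _).2 ⟨rfl, rfl, IDFAlgebra.oplus_core _⟩
  core_dup x := (GhostState.oplus_eq_some _ _ _).2 ⟨rfl, rfl, IDFAlgebra.core_dup _⟩
  core_max x c := by
    simp only [GhostState.oplus_eq_some]
    rintro ⟨-, h1, h2⟩
    obtain ⟨r, hr⟩ := IDFAlgebra.core_max _ _ h2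
    exact ⟨⟨x.store, r⟩, h1, rfl, hr⟩
  core_oplus a b c := by
    simp only [GhostState.oplus_eq_some]
    rintro ⟨h1, h2, h3⟩
    exact ⟨h1, h2, IDFAlgebra.core_oplus _ _ _ h3⟩
  cancel a b x y := by
    simp only [GhostState.oplus_eq_some]
    rintro ⟨-, h1, h2⟩ ⟨-, h3, h4⟩ h5
    have h6 : IDFAlgebra.core x.heap = IDFAlgebra.core y.heap := congrArg GhostState.heap h5
    exact GhostState.ext (h1.trans h3.symm) (IDFAlgebra.cancel _ _ _ _ h2 h4 h6)
  stable_eq x h := GhostState.ext rfl (IDFAlgebra.stable_eq _ h)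
  stable_stabilize x := IDFAlgebra.stable_stabilize x.heap
  stabilize_oplus a b c := by
    simp only [GhostState.oplus_eq_some]
    rintro ⟨h1, h2, h3⟩
    exact ⟨h1, h2, IDFAlgebra.stabilize_oplus _ _ _ h3⟩
  stabilize_core x := (GhostState.oplus_eq_some _ _ _).2 ⟨rfl, rfl, IDFAlgebra.stabilize_core _⟩
  unit_neutral a b c := by
    simp only [GhostState.oplus_eq_some]
    rintro ⟨h1, -, h3⟩
    exact GhostState.ext h1.symm (IDFAlgebra.unit_neutral _ _ _ h3)
  oplus_unit a := (GhostState.oplus_eq_some _ _ _).2 ⟨rfl, rfl, IDFAlgebra.oplus_unit _⟩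
  core_unit a := GhostState.ext rfl (IDFAlgebra.core_unit _)
  stable_unit a := IDFAlgebra.stable_unit a.heap

/-- A semantic assertion is independent of the local variable `x`. -/
def IndepOf {Var : Type uX} {V : Type uV} {HF : Type uG} [DecidableEq Var]
    (P : Set (GhostState Var V HF)) (x : Var) : Prop :=
  ∀ (w : GhostState Var V HF) (v : V), w ∈ P ↔ w.upd x v ∈ P

/-! ### Front-end parameters -/

/-- Type contexts: declared types of the local variables, and the typing information `D` that a
front-end uses for its heaps (for instance the types of the fields). -/
structure TypeContext (Var : Type uX) (T : Type uT) (D : Type uD) where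
  var : Var → Option T
  heap : D

/-- The parameters that describe an input language: `T` types, `V` values, `HF` ghost heaps,
`HP` program heaps, `BE` boolean expressions, `A` input assertions, `C` primitive statements,
`D` heap typing information. -/
structure FrontEnd (Var : Type uX) (T : Type uT) (V : Type uV) (HF : Type uG) (HP : Type uP)
    (BE : Type uB) (A : Type uA) (C : Type uC) (D : Type uD) where
  typ : V → T
  heapTyped : D → HP → Prop
  embedHeap : HP → HF
  evalBE : BE → GhostState Var V HF → Option Bool
  fvBE : BE → Set Var
  interpInput : TypeContext Var T D → A → Set (GhostState Var V HF)
  fvInput : A → Set Var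
  wfPrim : TypeContext Var T D → C → Prop
  redPrim : TypeContext Var T D → C → ProgState Var V HP → ProgState Var V HP → Prop
  cslPrim : TypeContext Var T D → Set (GhostState Var V HF) → C → Set (GhostState Var V HF) → Prop
  wrPrim : C → Set Var
  fvPrim : C → Set Var

/-- Front-end assertions. -/
inductive Assn (Var : Type uX) (T : Type uT) (BE : Type uB) (A : Type uA) where
  | input : A → Assn Var T BE A
  | bool : BE → Assn Var T BE A
  | sep : Assn Var T BE A → Assn Var T BE A → Assn Var T BE A
  | or : Assn Var T BE A → Assn Var T BE A → Assn Var T BE A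
  | imp : BE → Assn Var T BE A → Assn Var T BE A
  | ex : Var → T → Assn Var T BE A → Assn Var T BE A

/-- Front-end statements. Loops carry an invariant; both branches of a parallel composition
`par P₁ c₁ Q₁ P₂ c₂ Q₂` carry a pre- and a postcondition. -/
inductive Stmt (Var : Type uX) (T : Type uT) (BE : Type uB) (A : Type uA) (C : Type uC) where
  | skip : Stmt Var T BE A C
  | prim : C → Stmt Var T BE A C
  | seq : Stmt Var T BE A C → Stmt Var T BE A C → Stmt Var T BE A C
  | cond : BE → Stmt Var T BE A C → Stmt Var T BE A C → Stmt Var T BE A C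
  | loop : BE → Assn Var T BE A → Stmt Var T BE A C → Stmt Var T BE A C
  | par : Assn Var T BE A → Stmt Var T BE A C → Assn Var T BE A →
      Assn Var T BE A → Stmt Var T BE A C → Assn Var T BE A → Stmt Var T BE A C

namespace FrontEnd

variable {Var : Type uX} {T : Type uT} {V : Type uV} {HF : Type uG} {HP : Type uP}
  {BE : Type uB} {A : Type uA} {C : Type uC} {D : Type uD}

/-- The embedding of program states into ghost states. -/
def embed (F : FrontEnd Var T V HF HP BE A C D) (σ : ProgState Var V HP) : GhostState Var V HF :=
  ⟨σ.store, F.embedHeap σ.heap⟩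

/-- A program state is well-typed if exactly the declared variables have a value, each of its
declared type, and the heap is well-typed. -/
def WellTyped (F : FrontEnd Var T V HF HP BE A C D) (Δ : TypeContext Var T D)
    (σ : ProgState Var V HP) : Prop :=
  (∀ x, (σ.store x).map F.typ = Δ.var x) ∧ F.heapTyped Δ.heap σ.heap

/-- The interpretation of front-end assertions. -/
def interp [DecidableEq Var] [IDFAlgebra HF] (F : FrontEnd Var T V HF HP BE A C D)
    (Δ : TypeContext Var T D) : Assn Var T BE A → Set (GhostState Var V HF)
  | .input a => F.interpInput Δ a
  | .bool b => {w | F.evalBE b w = some true}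
  | .sep a₁ a₂ => sepConj (F.interp Δ a₁) (F.interp Δ a₂)
  | .or a₁ a₂ => F.interp Δ a₁ ∪ F.interp Δ a₂
  | .imp b a => {w | (F.evalBE b w).isSome ∧ (F.evalBE b w = some true → w ∈ F.interp Δ a)}
  | .ex x t a => {w | ∃ v, F.typ v = t ∧ w.upd x v ∈ F.interp Δ a}

/-- Free variables of assertions. -/
def fvAssn (F : FrontEnd Var T V HF HP BE A C D) : Assn Var T BE A → Set Var
  | .input a => F.fvInput a
  | .bool b => F.fvBE b
  | .sep a₁ a₂ => F.fvAssn a₁ ∪ F.fvAssn a₂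
  | .or a₁ a₂ => F.fvAssn a₁ ∪ F.fvAssn a₂
  | .imp b a => F.fvBE b ∪ F.fvAssn a
  | .ex x _ a => F.fvAssn a \ {x}

/-- Free variables of statements (annotations do not count). -/
def fv (F : FrontEnd Var T V HF HP BE A C D) : Stmt Var T BE A C → Set Var
  | .skip => ∅
  | .prim c => F.fvPrim c
  | .seq c₁ c₂ => F.fv c₁ ∪ F.fv c₂
  | .cond b c₁ c₂ => F.fvBE b ∪ F.fv c₁ ∪ F.fv c₂
  | .loop b _ c => F.fvBE b ∪ F.fv c
  | .par _ c₁ _ _ c₂ _ => F.fv c₁ ∪ F.fv c₂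

/-- Modified variables of statements. -/
def wr (F : FrontEnd Var T V HF HP BE A C D) : Stmt Var T BE A C → Set Var
  | .skip => ∅
  | .prim c => F.wrPrim c
  | .seq c₁ c₂ => F.wr c₁ ∪ F.wr c₂
  | .cond _ c₁ c₂ => F.wr c₁ ∪ F.wr c₂
  | .loop _ _ c => F.wr c
  | .par _ c₁ _ _ c₂ _ => F.wr c₁ ∪ F.wr c₂

/-- Well-formed statements. -/
def WF [DecidableEq Var] [IDFAlgebra HF] (F : FrontEnd Var T V HF HP BE A C D)
    (Δ : TypeContext Var T D) : Stmt Var T BE A C → Prop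
  | .skip => True
  | .prim c => F.wfPrim Δ c
  | .seq c₁ c₂ => F.WF Δ c₁ ∧ F.WF Δ c₂
  | .cond _ c₁ c₂ => F.WF Δ c₁ ∧ F.WF Δ c₂
  | .loop b I c => F.WF Δ c ∧ SelfFraming (F.interp Δ I) ∧ StableUnder (F.evalBE b) (F.interp Δ I)
  | .par P₁ c₁ Q₁ P₂ c₂ Q₂ => F.WF Δ c₁ ∧ F.WF Δ c₂ ∧
      SelfFraming (F.interp Δ P₁) ∧ SelfFraming (F.interp Δ Q₁) ∧
      SelfFraming (F.interp Δ P₂) ∧ SelfFraming (F.interp Δ Q₂) ∧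
      F.wr c₁ ∩ (F.fv c₂ ∪ F.fvAssn P₂ ∪ F.fvAssn Q₂) = ∅ ∧
      F.wr c₂ ∩ (F.fv c₁ ∪ F.fvAssn P₁ ∪ F.fvAssn Q₁) = ∅

/-! ### Small-step semantics -/

/-- `F.Red Δ c σ c' σ'`: one step from the configuration `(c, σ)` to `(c', σ')`. -/
inductive Red (F : FrontEnd Var T V HF HP BE A C D) (Δ : TypeContext Var T D) :
    Stmt Var T BE A C → ProgState Var V HP → Stmt Var T BE A C → ProgState Var V HP → Prop
  | prim {c σ σ'} : F.redPrim Δ c σ σ' → Red F Δ (.prim c) σ .skip σ'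
  | seqSkip {c σ} : Red F Δ (.seq .skip c) σ c σ
  | seq {c₁ c₁' c₂ σ σ'} : Red F Δ c₁ σ c₁' σ' → Red F Δ (.seq c₁ c₂) σ (.seq c₁' c₂) σ'
  | condT {b c₁ c₂ σ} : F.evalBE b (F.embed σ) = some true → Red F Δ (.cond b c₁ c₂) σ c₁ σ
  | condF {b c₁ c₂ σ} : F.evalBE b (F.embed σ) = some false → Red F Δ (.cond b c₁ c₂) σ c₂ σ
  | loop {b I c σ} : Red F Δ (.loop b I c) σ (.cond b (.seq c (.loop b I c)) .skip) σ
  | parSkip {P₁ Q₁ P₂ Q₂ σ} : Red F Δ (.par P₁ .skip Q₁ P₂ .skip Q₂) σ .skip σ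
  | parL {P₁ c₁ c₁' Q₁ P₂ c₂ Q₂ σ σ'} : Red F Δ c₁ σ c₁' σ' →
      Red F Δ (.par P₁ c₁ Q₁ P₂ c₂ Q₂) σ (.par P₁ c₁' Q₁ P₂ c₂ Q₂) σ'
  | parR {P₁ c₁ Q₁ P₂ c₂ c₂' Q₂ σ σ'} : Red F Δ c₂ σ c₂' σ' →
      Red F Δ (.par P₁ c₁ Q₁ P₂ c₂ Q₂) σ (.par P₁ c₁ Q₁ P₂ c₂' Q₂) σ'

/-- `F.RedStar Δ c σ c' σ'`: the reflexive transitive closure of the step relation. -/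
def RedStar (F : FrontEnd Var T V HF HP BE A C D) (Δ : TypeContext Var T D)
    (c : Stmt Var T BE A C) (σ : ProgState Var V HP)
    (c' : Stmt Var T BE A C) (σ' : ProgState Var V HP) : Prop :=
  Relation.ReflTransGen
    (fun p q : Stmt Var T BE A C × ProgState Var V HP => F.Red Δ p.1 p.2 q.1 q.2) (c, σ) (c', σ')

/-- `F.Aborts Δ c σ`: the configuration `(c, σ)` aborts, that is, some statement that is next in
line for execution, in any of the parallel threads, cannot be executed. -/
inductive Aborts (F : FrontEnd Var T V HF HP BE A C D) (Δ : TypeContext Var T D) :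
    Stmt Var T BE A C → ProgState Var V HP → Prop
  | prim {c σ} : (¬ ∃ σ', F.redPrim Δ c σ σ') → Aborts F Δ (.prim c) σ
  | seq {c₁ c₂ σ} : Aborts F Δ c₁ σ → Aborts F Δ (.seq c₁ c₂) σ
  | cond {b c₁ c₂ σ} : F.evalBE b (F.embed σ) = none → Aborts F Δ (.cond b c₁ c₂) σ
  | parL {P₁ c₁ Q₁ P₂ c₂ Q₂ σ} : Aborts F Δ c₁ σ → Aborts F Δ (.par P₁ c₁ Q₁ P₂ c₂ Q₂) σ
  | parR {P₁ c₁ Q₁ P₂ c₂ Q₂ σ} : Aborts F Δ c₂ σ → Aborts F Δ (.par P₁ c₁ Q₁ P₂ c₂ Q₂) σ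

/-- In particular, every configuration that is stuck without having terminated aborts. -/
theorem aborts_of_stuck (F : FrontEnd Var T V HF HP BE A C D) (Δ : TypeContext Var T D)
    (c : Stmt Var T BE A C) (σ : ProgState Var V HP) (hc : c ≠ .skip)
    (h : ¬ ∃ c' σ', F.Red Δ c σ c' σ') : F.Aborts Δ c σ := by
  induction c with
  | skip => exact absurd rfl hc
  | prim c => exact .prim fun ⟨σ', h'⟩ => h ⟨_, _, .prim h'⟩
  | seq c₁ c₂ ih₁ _ =>
    by_cases h₁ : c₁ = .skip
    · subst h₁
      exact absurd ⟨_, _, .seqSkip⟩ h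
    · exact .seq (ih₁ h₁ fun ⟨_, _, h'⟩ => h ⟨_, _, .seq h'⟩)
  | cond b c₁ c₂ _ _ =>
    refine .cond ?_
    rcases hb : F.evalBE b (F.embed σ) with _ | _ | _
    · rfl
    · exact absurd ⟨_, _, .condF hb⟩ h
    · exact absurd ⟨_, _, .condT hb⟩ h
  | loop b I c _ => exact absurd ⟨_, _, .loop⟩ h
  | par P₁ c₁ Q₁ P₂ c₂ Q₂ ih₁ ih₂ =>
    by_cases h₁ : c₁ = .skip
    · by_cases h₂ : c₂ = .skip
      · subst h₁ h₂
        exact absurd ⟨_, _, .parSkip⟩ h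
      · exact .parR (ih₂ h₂ fun ⟨_, _, h'⟩ => h ⟨_, _, .parR h'⟩)
    · exact .parL (ih₁ h₁ fun ⟨_, _, h'⟩ => h ⟨_, _, .parL h'⟩)

/-- Executing `c` from `σ` never aborts: no reachable configuration aborts. -/
def NeverAborts (F : FrontEnd Var T V HF HP BE A C D) (Δ : TypeContext Var T D)
    (c : Stmt Var T BE A C) (σ : ProgState Var V HP) : Prop :=
  ∀ c' σ', F.RedStar Δ c σ c' σ' → ¬ F.Aborts Δ c' σ'

/-! ### Concurrent separation logic -/

/-- `F.CSL Δ P c Q`: the triple `{P} c {Q}` is derivable. -/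
inductive CSL [DecidableEq Var] [IDFAlgebra HF] (F : FrontEnd Var T V HF HP BE A C D)
    (Δ : TypeContext Var T D) :
    Set (GhostState Var V HF) → Stmt Var T BE A C → Set (GhostState Var V HF) → Prop
  | skip {P} : SelfFraming P → CSL F Δ P .skip P
  | prim {P Q c} : SelfFraming P → SelfFraming Q → F.cslPrim Δ P c Q → CSL F Δ P (.prim c) Q
  | seq {P R Q c₁ c₂} : CSL F Δ P c₁ R → CSL F Δ R c₂ Q → CSL F Δ P (.seq c₁ c₂) Q
  | cond {P Q₁ Q₂ b c₁ c₂} : Frames P (F.evalBE b) →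
      CSL F Δ (P ∩ {w | F.evalBE b w = some true}) c₁ Q₁ →
      CSL F Δ (P ∩ {w | F.evalBE b w = some false}) c₂ Q₂ →
      CSL F Δ P (.cond b c₁ c₂) (Q₁ ∪ Q₂)
  | loop {P b I c} : Frames P (F.evalBE b) → StableUnder (F.evalBE b) P →
      CSL F Δ (P ∩ {w | F.evalBE b w = some true}) c P →
      CSL F Δ P (.loop b I c) (P ∩ {w | F.evalBE b w = some false})
  | par {P₁ Q₁ P₂ Q₂ A₁ B₁ A₂ B₂ c₁ c₂} : CSL F Δ P₁ c₁ Q₁ → CSL F Δ P₂ c₂ Q₂ →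
      F.fv c₁ ∩ F.wr c₂ = ∅ → F.fv c₂ ∩ F.wr c₁ = ∅ →
      (∀ x ∈ F.wr c₂, IndepOf P₁ x ∧ IndepOf Q₁ x) →
      (∀ x ∈ F.wr c₁, IndepOf P₂ x ∧ IndepOf Q₂ x) →
      CSL F Δ (sepConj P₁ P₂) (.par A₁ c₁ B₁ A₂ c₂ B₂) (sepConj Q₁ Q₂)
  | frame {P Q R c} : CSL F Δ P c Q → SelfFraming R → (∀ x ∈ F.wr c, IndepOf R x) →
      CSL F Δ (sepConj P R) c (sepConj Q R)
  | conseq {P Q P' Q' c} : CSL F Δ P c Q → P' ⊆ P → Q ⊆ Q' →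
      SelfFraming P' → SelfFraming Q' → CSL F Δ P' c Q'

/-! ### Requirements on the parameters -/

/-- The requirements on the parameters of the input language, for the type context `Δ`. -/
structure Requirements [DecidableEq Var] [IDFAlgebra HF] (F : FrontEnd Var T V HF HP BE A C D)
    (Δ : TypeContext Var T D) : Prop where
  fvBE_finite : ∀ b, (F.fvBE b).Finite
  fvInput_finite : ∀ a, (F.fvInput a).Finite
  fvPrim_finite : ∀ c, (F.fvPrim c).Finite
  wrPrim_finite : ∀ c, (F.wrPrim c).Finite
  /-- Boolean expressions are pure. -/
  evalBE_pure : ∀ b w, F.evalBE b w = F.evalBE b (IDFAlgebra.core w)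
  /-- Adding resources does not change the value of a boolean expression that is defined. -/
  evalBE_mono : ∀ b w w' v, Ge w' w → F.evalBE b w = some v → F.evalBE b w' = some v
  /-- `fvBE` overapproximates the free variables of a boolean expression. -/
  fvBE_sound : ∀ b x, x ∉ F.fvBE b → ∀ v w, F.evalBE b w = F.evalBE b (w.upd x v)
  /-- `fvInput` overapproximates the free variables of an input assertion. -/
  fvInput_sound : ∀ a x, x ∉ F.fvInput a → ∀ w v, Δ.var x = some (F.typ v) →
    (w ∈ F.interpInput Δ a ↔ w.upd x v ∈ F.interpInput Δ a)
  /-- The modified variables of a well-formed primitive statement are declared. -/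
  wrPrim_declared : ∀ c, F.wfPrim Δ c → ∀ x ∈ F.wrPrim c, (Δ.var x).isSome
  /-- The logic of primitive statements is affine. -/
  cslPrim_affine : ∀ P c Q, F.cslPrim Δ P c Q → F.cslPrim Δ (monotonize P) c (monotonize Q)
  /-- Reductions modify no local variable outside `wrPrim`. -/
  redPrim_wr : ∀ c σ σ', F.redPrim Δ c σ σ' → ∀ x ∉ F.wrPrim c, σ.store x = σ'.store x
  /-- Finitely many changes of local variables outside `fvPrim` do not affect reductions. -/
  redPrim_fv : ∀ c (X : Set Var), Xᶜ.Finite → F.fvPrim c ⊆ X →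
    ∀ σ₁ σ₂ σ₁', Set.EqOn σ₁.store σ₂.store X → σ₁.heap = σ₂.heap → F.redPrim Δ c σ₁ σ₁' →
    ∃ σ₂', F.redPrim Δ c σ₂ σ₂' ∧ Set.EqOn σ₁'.store σ₂'.store X ∧ σ₁'.heap = σ₂'.heap
  /-- Reductions of well-formed primitive statements preserve well-typedness. -/
  redPrim_typed : ∀ c σ σ', F.wfPrim Δ c → F.WellTyped Δ σ → F.redPrim Δ c σ σ' →
    F.WellTyped Δ σ'
  /-- Preconditions of well-formed primitive statements guarantee progress. -/
  cslPrim_progress : ∀ P c Q, F.wfPrim Δ c → F.cslPrim Δ P c Q → Monotone P →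
    ∀ σ w wf, F.WellTyped Δ σ → IDFAlgebra.oplus w wf = some (F.embed σ) → w ∈ P →
    IDFAlgebra.stable w → IDFAlgebra.stable wf → ∃ σ', F.redPrim Δ c σ σ'
  /-- Reductions of well-formed primitive statements establish the postcondition. -/
  cslPrim_post : ∀ P c Q, F.wfPrim Δ c → F.cslPrim Δ P c Q → Monotone P → Monotone Q →
    ∀ σ σ' w wf, F.WellTyped Δ σ → IDFAlgebra.oplus w wf = some (F.embed σ) → w ∈ P →
    IDFAlgebra.stable w → IDFAlgebra.stable wf → F.redPrim Δ c σ σ' →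
    ∃ w' wf', wf.heap = wf'.heap ∧ IDFAlgebra.stable w' ∧
      IDFAlgebra.oplus w' wf' = some (F.embed σ') ∧ w' ∈ Q

end FrontEnd

end FrontEndCSL

/-! The proof gives triples a step-indexed meaning and shows by induction on the derivation that
every rule respects it. `Safe n c s h Q` says that for `n` steps a thread with store `s`, owning the
stable ghost heap `h`, does not abort, and that each step turns `h` into a new stable heap while
leaving every stable frame heap untouched; if the thread is `skip`, it satisfies `Q`. Ownership
concerns heaps only: the store is shared, and interference on variables is excluded by the side
conditions on `fv` and `wr`.

Two mismatches have to be bridged. Requirement 7 speaks of monotone assertions, while assertions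
inside a derivation need not be monotone. So `Valid` is about monotone closures: affinity of the
primitive logic transports primitive triples, and the monotonicity of boolean expressions handles
branching. Secondly, owned heaps and frames must be stable, while `P * Q` only provides some
splitting. Every derivable triple has pre- and postconditions closed under stabilization
(`CSL.stabClosed`), and this lets a stable state be split into stable parts (`exists_stable_split`),
as the parallel and frame rules need.

`Safe.frame` moves the framed heap into the environment of the thread. `Safe.par` does the same with
the heap of the other thread, and uses `Safe.interference` to survive that thread's writes to the
store. At top level the program owns the whole embedded heap and the frame is a unit; monotonicity
of `Q` finally removes the closure. -/

namespace FrontEndCSL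

open IDFAlgebra (oplus stabilize stable)

/-! ### Stability, monotone closure and splitting in IDF algebras -/

section Algebra

variable {S : Type*} [IDFAlgebra S]

theorem oplus_assoc_right {a b c ab abc : S} (h : oplus a b = some ab)
    (h' : oplus ab c = some abc) : ∃ bc, oplus b c = some bc ∧ oplus a bc = some abc := by
  have key := IDFAlgebra.oplus_assoc a b c
  rw [h, Option.bind_some, h'] at key
  exact Option.bind_eq_some_iff.1 key

theorem oplus_assoc_left {a b c bc abc : S} (h : oplus b c = some bc)
    (h' : oplus a bc = some abc) : ∃ ab, oplus a b = some ab ∧ oplus ab c = some abc := by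
  have key := IDFAlgebra.oplus_assoc a b c
  rw [h, Option.bind_some, h'] at key
  exact Option.bind_eq_some_iff.1 key.symm

theorem Ge.refl (a : S) : Ge a a := ⟨_, IDFAlgebra.oplus_unit a⟩

theorem Ge.trans {a b c : S} (h : Ge a b) (h' : Ge b c) : Ge a c := by
  obtain ⟨r, hr⟩ := h
  obtain ⟨q, hq⟩ := h'
  obtain ⟨t, -, ht⟩ := oplus_assoc_right hq hr
  exact ⟨t, ht⟩

theorem Ge.stabilize {a b : S} (h : Ge a b) : Ge (stabilize a) (stabilize b) := by
  obtain ⟨r, hr⟩ := h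
  exact ⟨_, IDFAlgebra.stabilize_oplus _ _ _ hr⟩

theorem stable_oplus {a b c : S} (ha : stable a) (hb : stable b) (h : oplus a b = some c) :
    stable c := by
  have h' := IDFAlgebra.stabilize_oplus _ _ _ h
  rw [← IDFAlgebra.stable_eq a ha, ← IDFAlgebra.stable_eq b hb, h, Option.some_inj] at h'
  rw [h']
  exact IDFAlgebra.stable_stabilize _

theorem subset_monotonize (P : Set S) : P ⊆ monotonize P := fun w hw => ⟨w, Ge.refl w, hw⟩

theorem monotone_monotonize (P : Set S) : Monotone (monotonize P) := by
  rintro w ⟨w₀, h, h₀⟩ w' h'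
  exact ⟨w₀, h'.trans h, h₀⟩

theorem monotonize_mono {P Q : Set S} (h : P ⊆ Q) : monotonize P ⊆ monotonize Q := by
  rintro w ⟨w₀, h₁, h₀⟩
  exact ⟨w₀, h₁, h h₀⟩

theorem Monotone.monotonize_subset {P : Set S} (hP : Monotone P) : monotonize P ⊆ P := by
  rintro w ⟨w₀, h, h₀⟩
  exact hP w₀ h₀ w h

/-- The surplus of both summands is collected to the right by associativity and commutativity. This
returns from separate closures to the closure of `Q₁ * Q₂` in the parallel and frame rules. -/
theorem sepConj_monotonize_subset (P Q : Set S) :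
    sepConj (monotonize P) (monotonize Q) ⊆ monotonize (sepConj P Q) := by
  rintro w ⟨w₁, ⟨u₁, ⟨r₁, h₁⟩, hu₁⟩, w₂, ⟨u₂, ⟨r₂, h₂⟩, hu₂⟩, h⟩
  obtain ⟨x, hx, hx'⟩ := oplus_assoc_right h₁ h
  rw [IDFAlgebra.oplus_comm] at hx
  obtain ⟨y, hy, hy'⟩ := oplus_assoc_right h₂ hx
  obtain ⟨z, hz, hz'⟩ := oplus_assoc_left hx hx'
  obtain ⟨t, ht, ht'⟩ := oplus_assoc_left h₂ hz
  exact ⟨t, Ge.trans (b := z) ⟨_, hz'⟩ ⟨_, ht'⟩, u₁, hu₁, u₂, hu₂, ht⟩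

/-- Closure under stabilization: the forward direction of self-framing. -/
def StabClosed (P : Set S) : Prop := ∀ w ∈ P, stabilize w ∈ P

theorem SelfFraming.stabClosed {P : Set S} (h : SelfFraming P) : StabClosed P :=
  fun w hw => (h w).1 hw

theorem StabClosed.sepConj {P Q : Set S} (hP : StabClosed P) (hQ : StabClosed Q) :
    StabClosed (sepConj P Q) := by
  rintro w ⟨w₁, h₁, w₂, h₂, h⟩
  exact ⟨_, hP _ h₁, _, hQ _ h₂, IDFAlgebra.stabilize_oplus _ _ _ h⟩

theorem StabClosed.union {P Q : Set S} (hP : StabClosed P) (hQ : StabClosed Q) :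
    StabClosed (P ∪ Q) := by
  rintro w (h | h)
  exacts [.inl (hP _ h), .inr (hQ _ h)]

/-- Stabilization is additive and fixes the stable `w`, so stabilizing the parts of any splitting
gives another splitting of `w`, now into stable parts. -/
theorem exists_stable_split {P Q : Set S} (hP : StabClosed P) (hQ : StabClosed Q) {w : S}
    (hw : stable w) (h : w ∈ monotonize (sepConj P Q)) :
    ∃ w₁ ∈ monotonize P, ∃ w₂ ∈ monotonize Q,
      stable w₁ ∧ stable w₂ ∧ oplus w₁ w₂ = some w := by
  obtain ⟨w₀, ⟨r, hr⟩, w₁, h₁, w₂, h₂, h₀⟩ := h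
  obtain ⟨u, hu, hu'⟩ := oplus_assoc_right h₀ hr
  -- The surplus `r` goes to the second part: the witnesses are the stabilizations of `w₁` and `u =
  -- w₂ ⊕ r`.
  refine ⟨_, subset_monotonize _ (hP _ h₁), _, ⟨_, Ge.stabilize ⟨r, hu⟩, hQ _ h₂⟩,
    IDFAlgebra.stable_stabilize _, IDFAlgebra.stable_stabilize _, ?_⟩
  rw [IDFAlgebra.stabilize_oplus _ _ _ hu', ← IDFAlgebra.stable_eq w hw]

end Algebra

/-! ### Assertions under changes of variables -/

section Stores

variable {Var : Type uX} {V : Type uV} {HF : Type uG} [DecidableEq Var]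

/-- `P` is closed under overwriting `x`: the forward direction of independence. -/
def UpdClosed (P : Set (GhostState Var V HF)) (x : Var) : Prop :=
  ∀ w ∈ P, ∀ v : V, w.upd x v ∈ P

theorem IndepOf.updClosed {P : Set (GhostState Var V HF)} {x : Var} (h : IndepOf P x) :
    UpdClosed P x := fun w hw v => (h w v).1 hw

theorem UpdClosed.monotonize [IDFAlgebra HF] {P : Set (GhostState Var V HF)} {x : Var}
    (h : UpdClosed P x) : UpdClosed (monotonize P) x := by
  rintro w ⟨w₀, ⟨r, hr⟩, h₀⟩ v
  obtain ⟨h₁, h₂, h₃⟩ := (GhostState.oplus_eq_some _ _ _).1 hr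
  have hu : ∀ u : GhostState Var V HF, u.store = w.store → (u.upd x v).store = (w.upd x v).store :=
    fun u hu => by simp only [GhostState.upd, hu]
  exact ⟨w₀.upd x v, ⟨r.upd x v, (GhostState.oplus_eq_some _ _ _).2 ⟨hu _ h₁, hu _ h₂, h₃⟩⟩,
    h _ h₀ v⟩

/-- The variables in `X` are overwritten one at a time, hence finiteness. Overwriting can only store
a value, never erase one, hence the condition that `s'` is defined on `X`. -/
theorem mem_of_eqOn_compl {P : Set (GhostState Var V HF)} {X : Set Var} (hX : X.Finite)
    (hP : ∀ x ∈ X, UpdClosed P x) {s s' : Var → Option V} {h : HF}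
    (hs : ∀ x ∉ X, s x = s' x) (hs' : ∀ x ∈ X, (s' x).isSome) (hmem : ⟨s, h⟩ ∈ P) :
    ⟨s', h⟩ ∈ P := by
  induction X, hX using Set.Finite.induction_on generalizing s with
  | empty =>
    have : s = s' := funext fun x => hs x (Set.notMem_empty x)
    exact this ▸ hmem
  | @insert a X _ _ ih =>
    obtain ⟨v, hv⟩ := Option.isSome_iff_exists.1 (hs' a (Set.mem_insert _ _))
    refine ih (fun x hx => hP x (.inr hx)) (s := Function.update s a (some v)) ?_
      (fun x hx => hs' x (.inr hx)) (hP a (.inl rfl) _ hmem v)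
    intro x hx
    by_cases hxa : x = a
    · subst hxa
      rw [Function.update_self, hv]
    · rw [Function.update_of_ne hxa]
      exact hs x fun h => h.elim hxa hx

end Stores

/-! ### Invariants of reduction, and safety -/

namespace FrontEnd

variable {Var : Type uX} {T : Type uT} {V : Type uV} {HF : Type uG} {HP : Type uP}
  {BE : Type uB} {A : Type uA} {C : Type uC} {D : Type uD}
  {F : FrontEnd Var T V HF HP BE A C D} {Δ : TypeContext Var T D}

/-- All primitive statements in a statement are well-formed. -/
def PrimWF (F : FrontEnd Var T V HF HP BE A C D) (Δ : TypeContext Var T D) :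
    Stmt Var T BE A C → Prop
  | .skip => True
  | .prim c => F.wfPrim Δ c
  | .seq c₁ c₂ => F.PrimWF Δ c₁ ∧ F.PrimWF Δ c₂
  | .cond _ c₁ c₂ => F.PrimWF Δ c₁ ∧ F.PrimWF Δ c₂
  | .loop _ _ c => F.PrimWF Δ c
  | .par _ c₁ _ _ c₂ _ => F.PrimWF Δ c₁ ∧ F.PrimWF Δ c₂

/-- The part of well-typedness that concerns stores. -/
def StoreTyped (F : FrontEnd Var T V HF HP BE A C D) (Δ : TypeContext Var T D)
    (s : Var → Option V) : Prop := ∀ x, (s x).map F.typ = Δ.var x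

theorem StoreTyped.isSome {s : Var → Option V} (hs : F.StoreTyped Δ s) {x : Var}
    (hx : (Δ.var x).isSome) : (s x).isSome := by
  rw [← hs x, Option.isSome_map] at hx
  exact hx

theorem Red.fv_subset {c c' : Stmt Var T BE A C} {σ σ' : ProgState Var V HP}
    (h : F.Red Δ c σ c' σ') : F.fv c' ⊆ F.fv c := by
  induction h <;> simp only [FrontEnd.fv] at * <;> grind

theorem Red.wr_subset {c c' : Stmt Var T BE A C} {σ σ' : ProgState Var V HP}
    (h : F.Red Δ c σ c' σ') : F.wr c' ⊆ F.wr c := by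
  induction h <;> simp only [FrontEnd.wr] at * <;> grind

theorem Red.primWF {c c' : Stmt Var T BE A C} {σ σ' : ProgState Var V HP}
    (h : F.Red Δ c σ c' σ') (hc : F.PrimWF Δ c) : F.PrimWF Δ c' := by
  induction h <;> simp only [FrontEnd.PrimWF] at * <;> tauto

section

variable [IDFAlgebra HF]

theorem embed_ge {s : Var → Option V} {h hf : HF} {hp : HP}
    (ho : oplus h hf = some (F.embedHeap hp)) :
    Ge (F.embed ⟨s, hp⟩) (⟨s, h⟩ : GhostState Var V HF) :=
  ⟨⟨s, hf⟩, (GhostState.oplus_eq_some _ _ _).2 ⟨rfl, rfl, ho⟩⟩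

theorem exists_stable_heap_split {P Q : Set (GhostState Var V HF)} (hP : StabClosed P)
    (hQ : StabClosed Q) {s : Var → Option V} {h : HF} (hst : stable h)
    (hmem : ⟨s, h⟩ ∈ monotonize (sepConj P Q)) :
    ∃ h₁ h₂, ⟨s, h₁⟩ ∈ monotonize P ∧ ⟨s, h₂⟩ ∈ monotonize Q ∧ stable h₁ ∧ stable h₂ ∧
      oplus h₁ h₂ = some h := by
  obtain ⟨⟨s₁, h₁⟩, m₁, ⟨s₂, h₂⟩, m₂, st₁, st₂, ho⟩ :=
    exists_stable_split hP hQ (w := ⟨s, h⟩) hst hmem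
  obtain ⟨rfl, rfl, ho'⟩ := (GhostState.oplus_eq_some _ _ _).1 ho
  exact ⟨h₁, h₂, m₁, m₂, st₁, st₂, ho'⟩

/-! ### Step-indexed safety -/

/-- `F.Safe Δ n c s h Q`: for `n` steps, executing `c` with store `s` and owned stable ghost heap
`h` does not abort, preserves every stable frame, and establishes `Q` upon termination. -/
def Safe (F : FrontEnd Var T V HF HP BE A C D) (Δ : TypeContext Var T D) :
    ℕ → Stmt Var T BE A C → (Var → Option V) → HF → Set (GhostState Var V HF) → Prop
  | 0, _, _, _, _ => True
  | n + 1, c, s, h, Q => (c = .skip → ⟨s, h⟩ ∈ Q) ∧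
      ∀ hp hf, F.WellTyped Δ ⟨s, hp⟩ → stable hf → oplus h hf = some (F.embedHeap hp) →
        ¬ F.Aborts Δ c ⟨s, hp⟩ ∧
        ∀ c' σ', F.Red Δ c ⟨s, hp⟩ c' σ' → ∃ h', stable h' ∧
          oplus h' hf = some (F.embedHeap σ'.heap) ∧ Safe F Δ n c' σ'.store h' Q

theorem Safe.of_succ {n : ℕ} {c : Stmt Var T BE A C} {s : Var → Option V} {h : HF}
    {Q : Set (GhostState Var V HF)} (hs : F.Safe Δ (n + 1) c s h Q) : F.Safe Δ n c s h Q := by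
  induction n generalizing c s h with
  | zero => trivial
  | succ n ih =>
    refine ⟨hs.1, fun hp hf ht hst ho => ⟨(hs.2 hp hf ht hst ho).1, fun c' σ' hr => ?_⟩⟩
    obtain ⟨h', h₁, h₂, h₃⟩ := (hs.2 hp hf ht hst ho).2 c' σ' hr
    exact ⟨h', h₁, h₂, ih h₃⟩

theorem Safe.mono {n : ℕ} {c : Stmt Var T BE A C} {s : Var → Option V} {h : HF}
    {Q Q' : Set (GhostState Var V HF)} (hQ : Q ⊆ Q') (hs : F.Safe Δ n c s h Q) :
    F.Safe Δ n c s h Q' := by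
  induction n generalizing c s h with
  | zero => trivial
  | succ n ih =>
    refine ⟨fun hc => hQ (hs.1 hc),
      fun hp hf ht hst ho => ⟨(hs.2 hp hf ht hst ho).1, fun c' σ' hr => ?_⟩⟩
    obtain ⟨h', h₁, h₂, h₃⟩ := (hs.2 hp hf ht hst ho).2 c' σ' hr
    exact ⟨h', h₁, h₂, ih h₃⟩

theorem safe_skip {s : Var → Option V} {h : HF} {Q : Set (GhostState Var V HF)}
    (hQ : ⟨s, h⟩ ∈ Q) (n : ℕ) : F.Safe Δ n .skip s h Q := by
  cases n with
  | zero => trivial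
  | succ n => exact ⟨fun _ => hQ, fun _ _ _ _ _ => ⟨nofun, nofun⟩⟩

/-- Passing from `skip; c₂` to `c₂` costs a step, so safety of `c₂` is needed only at indices below
`n`. The loop rule relies on this to apply its induction hypothesis. -/
theorem Safe.seq {n : ℕ} {c₁ c₂ : Stmt Var T BE A C} {s : Var → Option V} {h : HF}
    {R Q : Set (GhostState Var V HF)} (hs : F.Safe Δ n c₁ s h R) (hh : stable h)
    (hR : ∀ m < n, ∀ s' h', F.StoreTyped Δ s' → stable h' → ⟨s', h'⟩ ∈ R →
      F.Safe Δ m c₂ s' h' Q) : F.Safe Δ n (.seq c₁ c₂) s h Q := by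
  induction n generalizing c₁ s h with
  | zero => trivial
  | succ n ih =>
    refine ⟨nofun, fun hp hf ht hst ho => ?_⟩
    obtain ⟨hab, hred⟩ := hs.2 hp hf ht hst ho
    refine ⟨fun | .seq h => hab h, fun c' σ' hr => ?_⟩
    cases hr with
    | seqSkip => exact ⟨h, hh, ho, hR n n.lt_succ_self _ _ ht.1 hh (hs.1 rfl)⟩
    | seq hr =>
      obtain ⟨h', h₁, h₂, h₃⟩ := hred _ _ hr
      exact ⟨h', h₁, h₂, ih h₃ h₁ fun m hm => hR m (hm.trans n.lt_succ_self)⟩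

end

variable [DecidableEq Var] [IDFAlgebra HF]

theorem WF.primWF {c : Stmt Var T BE A C} (h : F.WF Δ c) : F.PrimWF Δ c := by
  induction c <;> simp only [FrontEnd.WF, FrontEnd.PrimWF] at * <;> tauto

theorem Red.store_eq (hF : F.Requirements Δ) {c c' : Stmt Var T BE A C}
    {σ σ' : ProgState Var V HP} (h : F.Red Δ c σ c' σ') :
    ∀ x ∉ F.wr c, σ.store x = σ'.store x := by
  induction h with
  | prim h => exact hF.redPrim_wr _ _ _ h
  | seq _ ih | parL _ ih => exact fun x hx => ih x fun h => hx (.inl h)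
  | parR _ ih => exact fun x hx => ih x fun h => hx (.inr h)
  | _ => exact fun _ _ => rfl

theorem Red.wellTyped (hF : F.Requirements Δ) {c c' : Stmt Var T BE A C}
    {σ σ' : ProgState Var V HP} (h : F.Red Δ c σ c' σ') (hc : F.PrimWF Δ c)
    (hσ : F.WellTyped Δ σ) : F.WellTyped Δ σ' := by
  induction h with
  | prim h => exact hF.redPrim_typed _ _ _ hc hσ h
  | seq _ ih | parL _ ih => exact ih hc.1 hσ
  | parR _ ih => exact ih hc.2 hσ
  | _ => exact hσ

theorem Requirements.wr_finite (hF : F.Requirements Δ) (c : Stmt Var T BE A C) :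
    (F.wr c).Finite := by
  induction c with
  | skip => exact Set.finite_empty
  | prim c => exact hF.wrPrim_finite c
  | seq _ _ ih₁ ih₂ | cond _ _ _ ih₁ ih₂ | par _ _ _ _ _ _ ih₁ ih₂ => exact ih₁.union ih₂
  | loop _ _ _ ih => exact ih

theorem Requirements.wr_declared (hF : F.Requirements Δ) {c : Stmt Var T BE A C}
    (hc : F.PrimWF Δ c) : ∀ x ∈ F.wr c, (Δ.var x).isSome := by
  induction c with
  | skip => exact fun _ h => h.elim
  | prim c => exact hF.wrPrim_declared c hc
  | seq _ _ ih₁ ih₂ | cond _ _ _ ih₁ ih₂ | par _ _ _ _ _ _ ih₁ ih₂ =>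
    exact fun x hx => hx.elim (ih₁ hc.1 x) (ih₂ hc.2 x)
  | loop _ _ _ ih => exact ih hc

/-! ### Dependence of executions on free variables only -/

theorem Requirements.evalBE_congr (hF : F.Requirements Δ) {b : BE} {X : Set Var}
    (hX : Xᶜ.Finite) (hb : F.fvBE b ⊆ X) {s s' : Var → Option V} (hs : Set.EqOn s s' X)
    (hs' : ∀ x ∉ X, (s' x).isSome) (h : HF) : F.evalBE b ⟨s, h⟩ = F.evalBE b ⟨s', h⟩ := by
  -- The level set of `b` through `⟨s, h⟩` is closed under overwriting variables outside `fvBE b`.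
  refine Eq.symm (mem_of_eqOn_compl (P := {w | F.evalBE b w = F.evalBE b ⟨s, h⟩}) hX ?_
    (fun x hx => hs (not_not.1 hx)) hs' rfl)
  intro x hx w hw v
  exact (hF.fvBE_sound b x (fun hxb => hx (hb hxb)) v w).symm.trans hw

theorem Red.congr_store (hF : F.Requirements Δ) {c c' : Stmt Var T BE A C}
    {σ σ' τ : ProgState Var V HP} (h : F.Red Δ c σ c' σ') {X : Set Var} (hX : Xᶜ.Finite)
    (hc : F.fv c ⊆ X) (hs : Set.EqOn σ.store τ.store X) (hτ : ∀ x ∉ X, (τ.store x).isSome)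
    (hh : σ.heap = τ.heap) :
    ∃ τ', F.Red Δ c τ c' τ' ∧ Set.EqOn σ'.store τ'.store X ∧ σ'.heap = τ'.heap := by
  induction h with
  | prim h =>
    obtain ⟨τ', h₁, h₂⟩ := hF.redPrim_fv _ X hX hc _ _ _ hs hh h
    exact ⟨τ', .prim h₁, h₂⟩
  | seqSkip => exact ⟨τ, .seqSkip, hs, hh⟩
  | loop => exact ⟨τ, .loop, hs, hh⟩
  | parSkip => exact ⟨τ, .parSkip, hs, hh⟩
  | seq _ ih =>
    obtain ⟨τ', h₁, h₂⟩ := ih (Set.union_subset_iff.1 hc).1 hs hh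
    exact ⟨τ', .seq h₁, h₂⟩
  | parL _ ih =>
    obtain ⟨τ', h₁, h₂⟩ := ih (Set.union_subset_iff.1 hc).1 hs hh
    exact ⟨τ', .parL h₁, h₂⟩
  | parR _ ih =>
    obtain ⟨τ', h₁, h₂⟩ := ih (Set.union_subset_iff.1 hc).2 hs hh
    exact ⟨τ', .parR h₁, h₂⟩
  | condT hb =>
    refine ⟨τ, .condT ?_, hs, hh⟩
    rw [← hb, FrontEnd.embed, FrontEnd.embed, hh]
    exact (hF.evalBE_congr hX (fun x hx => hc (.inl (.inl hx))) hs hτ _).symm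
  | condF hb =>
    refine ⟨τ, .condF ?_, hs, hh⟩
    rw [← hb, FrontEnd.embed, FrontEnd.embed, hh]
    exact (hF.evalBE_congr hX (fun x hx => hc (.inl (.inl hx))) hs hτ _).symm

theorem Aborts.congr_store (hF : F.Requirements Δ) {c : Stmt Var T BE A C}
    {σ τ : ProgState Var V HP} (h : F.Aborts Δ c σ) {X : Set Var} (hX : Xᶜ.Finite)
    (hc : F.fv c ⊆ X) (hs : Set.EqOn σ.store τ.store X) (hτ : ∀ x ∉ X, (τ.store x).isSome)
    (hh : σ.heap = τ.heap) : F.Aborts Δ c τ := by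
  induction h with
  | prim h =>
    refine .prim fun ⟨τ', hτ'⟩ => h ?_
    obtain ⟨σ', h₁, -⟩ := hF.redPrim_fv _ X hX hc _ _ _ hs.symm hh.symm hτ'
    exact ⟨σ', h₁⟩
  | seq _ ih => exact .seq (ih (Set.union_subset_iff.1 hc).1 hs hh)
  | parL _ ih => exact .parL (ih (Set.union_subset_iff.1 hc).1 hs hh)
  | parR _ ih => exact .parR (ih (Set.union_subset_iff.1 hc).2 hs hh)
  | cond hb =>
    refine .cond ?_
    rw [← hb, FrontEnd.embed, FrontEnd.embed, hh]
    exact (hF.evalBE_congr hX (fun x hx => hc (.inl (.inl hx))) hs hτ _).symm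

/-! ### Framing and parallel composition of safe executions -/

theorem Safe.frame (hF : F.Requirements Δ) {n : ℕ} {c : Stmt Var T BE A C}
    {s : Var → Option V} {h hr k : HF} {Q R : Set (GhostState Var V HF)}
    (hs : F.Safe Δ n c s h Q) (hc : F.PrimWF Δ c) (hr_stable : stable hr)
    (hR : ∀ x ∈ F.wr c, UpdClosed R x) (hmem : ⟨s, hr⟩ ∈ R) (hk : oplus h hr = some k) :
    F.Safe Δ n c s k (sepConj Q R) := by
  induction n generalizing c s h k with
  | zero => trivial
  | succ n ih =>
    refine ⟨fun e => ⟨_, hs.1 e, _, hmem, (GhostState.oplus_eq_some _ _ _).2 ⟨rfl, rfl, hk⟩⟩,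
      fun hp hf ht hst ho => ?_⟩
    -- From the viewpoint of `c`, the frame is `g = hr ⊕ hf`, which is stable as a sum of stable
    -- heaps.
    obtain ⟨g, hg, hg'⟩ := oplus_assoc_right hk ho
    obtain ⟨hab, hred⟩ := hs.2 hp g ht (stable_oplus hr_stable hst hg) hg'
    refine ⟨hab, fun c' σ' hstep => ?_⟩
    obtain ⟨h', h₁, h₂, h₃⟩ := hred _ _ hstep
    obtain ⟨k', hk', hk''⟩ := oplus_assoc_left hg h₂
    refine ⟨k', stable_oplus h₁ hr_stable hk', hk'', ih h₃ (hstep.primWF hc)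
      (fun x hx => hR x (hstep.wr_subset hx)) ?_ hk'⟩
    exact mem_of_eqOn_compl (hF.wr_finite c) hR (hstep.store_eq hF)
      (fun x hx => StoreTyped.isSome (hstep.wellTyped hF hc ht).1 (hF.wr_declared hc x hx)) hmem

/-- A simulation: an abort or step from `s'` is replayed from `s`, where safety applies, and the
resulting stores again agree on `X`. Typing makes both stores defined outside `X`, since those
variables are declared. -/
theorem Safe.congr_store (hF : F.Requirements Δ) {n : ℕ} {c : Stmt Var T BE A C}
    {s s' : Var → Option V} {h : HF} {Q : Set (GhostState Var V HF)} {X : Set Var}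
    (hX : Xᶜ.Finite) (hdecl : ∀ x ∉ X, (Δ.var x).isSome) (hQ : ∀ x ∉ X, UpdClosed Q x)
    (hs : F.Safe Δ n c s h Q) (hc : F.PrimWF Δ c) (hfv : F.fv c ⊆ X)
    (hst : F.StoreTyped Δ s) (hst' : F.StoreTyped Δ s') (heq : Set.EqOn s s' X) :
    F.Safe Δ n c s' h Q := by
  induction n generalizing c s s' h with
  | zero => trivial
  | succ n ih =>
    refine ⟨fun e => mem_of_eqOn_compl hX hQ (fun x hx => heq (not_not.1 hx))
      (fun x hx => hst'.isSome (hdecl x hx)) (hs.1 e), fun hp hf ht hfst ho => ?_⟩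
    -- Heap typing does not mention the store, so it carries over from `s'` to `s`.
    obtain ⟨hab, hred⟩ := hs.2 hp hf ⟨hst, ht.2⟩ hfst ho
    have hsome : ∀ x ∉ X, (s x).isSome := fun x hx => hst.isSome (hdecl x hx)
    refine ⟨fun ha => hab (ha.congr_store hF hX hfv heq.symm hsome rfl), fun c' σ' hr => ?_⟩
    obtain ⟨τ', hτ, heq', hheap⟩ := hr.congr_store hF hX hfv (τ := ⟨s, hp⟩) heq.symm hsome rfl
    obtain ⟨h', h₁, h₂, h₃⟩ := hred _ _ hτ
    refine ⟨h', h₁, hheap ▸ h₂, ih h₃ (hτ.primWF hc) (hτ.fv_subset.trans hfv)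
      (hτ.wellTyped hF hc ⟨hst, ht.2⟩).1 (hr.wellTyped hF hc ht).1 heq'.symm⟩

/-- A step of `d` changes the store only on the finite, declared set `wr d`, so `Safe.congr_store`
applies with its complement as `X`. -/
theorem Safe.interference (hF : F.Requirements Δ) {n : ℕ} {c d d' : Stmt Var T BE A C}
    {σ σ' : ProgState Var V HP} {h : HF} {Q : Set (GhostState Var V HF)}
    (hs : F.Safe Δ n c σ.store h Q) (hc : F.PrimWF Δ c) (hd : F.PrimWF Δ d)
    (hσ : F.WellTyped Δ σ) (hr : F.Red Δ d σ d' σ') (hdisj : Disjoint (F.fv c) (F.wr d))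
    (hQ : ∀ x ∈ F.wr d, UpdClosed Q x) : F.Safe Δ n c σ'.store h Q := by
  refine hs.congr_store hF (X := (F.wr d)ᶜ) ?_ ?_ ?_ hc hdisj.subset_compl_right hσ.1
    (hr.wellTyped hF hd hσ).1 (hr.store_eq hF)
  · rw [compl_compl]
    exact hF.wr_finite d
  · exact fun x hx => hF.wr_declared hd x (not_not.1 hx)
  · exact fun x hx => hQ x (not_not.1 hx)

theorem Safe.par (hF : F.Requirements Δ) {n : ℕ} {c₁ c₂ : Stmt Var T BE A C}
    {s : Var → Option V} {h₁ h₂ h : HF} {Q₁ Q₂ : Set (GhostState Var V HF)}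
    {A₁ B₁ A₂ B₂ : Assn Var T BE A}
    (hs₁ : F.Safe Δ n c₁ s h₁ Q₁) (hs₂ : F.Safe Δ n c₂ s h₂ Q₂)
    (hc₁ : F.PrimWF Δ c₁) (hc₂ : F.PrimWF Δ c₂)
    (hd₁ : Disjoint (F.fv c₁) (F.wr c₂)) (hd₂ : Disjoint (F.fv c₂) (F.wr c₁))
    (hQ₁ : ∀ x ∈ F.wr c₂, UpdClosed Q₁ x) (hQ₂ : ∀ x ∈ F.wr c₁, UpdClosed Q₂ x)
    (hst₁ : stable h₁) (hst₂ : stable h₂) (hh : oplus h₁ h₂ = some h) :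
    F.Safe Δ n (.par A₁ c₁ B₁ A₂ c₂ B₂) s h (sepConj Q₁ Q₂) := by
  induction n generalizing c₁ c₂ s h₁ h₂ h with
  | zero => trivial
  | succ n ih =>
    refine ⟨nofun, fun hp hf ht hst ho => ?_⟩
    -- Each thread sees the other's heap as part of its frame: `g₁ = h₂ ⊕ hf` and `g₂ = h₁ ⊕ hf`.
    obtain ⟨g₁, hg₁, hg₁'⟩ := oplus_assoc_right hh ho
    obtain ⟨g₂, hg₂, hg₂'⟩ := oplus_assoc_right ((IDFAlgebra.oplus_comm _ _).trans hh) ho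
    obtain ⟨hab₁, hred₁⟩ := hs₁.2 hp g₁ ht (stable_oplus hst₂ hst hg₁) hg₁'
    obtain ⟨hab₂, hred₂⟩ := hs₂.2 hp g₂ ht (stable_oplus hst₁ hst hg₂) hg₂'
    refine ⟨?_, fun c' σ' hr => ?_⟩
    · rintro (_ | _ | _ | h | h)
      exacts [hab₁ h, hab₂ h]
    · cases hr with
      | parSkip =>
        exact ⟨h, stable_oplus hst₁ hst₂ hh, ho, safe_skip (show ⟨s, h⟩ ∈ sepConj Q₁ Q₂ from
          ⟨_, hs₁.1 rfl, _, hs₂.1 rfl, (GhostState.oplus_eq_some _ _ _).2 ⟨rfl, rfl, hh⟩⟩) n⟩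
      | parL hr =>
        obtain ⟨h', hst', ho', hs'⟩ := hred₁ _ _ hr
        obtain ⟨k, hk, hk'⟩ := oplus_assoc_left hg₁ ho'
        exact ⟨k, stable_oplus hst' hst₂ hk, hk',
          ih hs' (hs₂.of_succ.interference (σ := ⟨s, hp⟩) hF hc₂ hc₁ ht hr hd₂ hQ₂)
            (hr.primWF hc₁) hc₂ (hd₁.mono_left hr.fv_subset) (hd₂.mono_right hr.wr_subset)
            hQ₁ (fun x hx => hQ₂ x (hr.wr_subset hx)) hst' hst₂ hk⟩
      | parR hr =>
        obtain ⟨h', hst', ho', hs'⟩ := hred₂ _ _ hr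
        obtain ⟨k, hk, hk'⟩ := oplus_assoc_left hg₂ ho'
        exact ⟨k, stable_oplus hst' hst₁ hk, hk',
          ih (hs₁.of_succ.interference (σ := ⟨s, hp⟩) hF hc₁ hc₂ ht hr hd₁ hQ₁) hs'
            hc₁ (hr.primWF hc₂) (hd₁.mono_right hr.wr_subset) (hd₂.mono_left hr.fv_subset)
            (fun x hx => hQ₁ x (hr.wr_subset hx)) hQ₂ hst₁ hst'
            ((IDFAlgebra.oplus_comm _ _).trans hk)⟩

/-! ### Semantic triples -/

/-- Semantic triples, about the monotone closures of the pre- and postcondition. -/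
def Valid (F : FrontEnd Var T V HF HP BE A C D) (Δ : TypeContext Var T D)
    (P : Set (GhostState Var V HF)) (c : Stmt Var T BE A C) (Q : Set (GhostState Var V HF)) :
    Prop :=
  ∀ n s h, F.StoreTyped Δ s → stable h → ⟨s, h⟩ ∈ monotonize P →
    F.Safe Δ n c s h (monotonize Q)

/-- Below `w` lies some `w₀ ∈ P`, where `b` is defined; its value there persists upwards to `w'`.
Hence the branch chosen in the full state is the one whose precondition holds of the owned part. -/
theorem Requirements.mem_monotonize_inter (hF : F.Requirements Δ) {b : BE}
    {P : Set (GhostState Var V HF)} (hP : Frames P (F.evalBE b)) {w w' : GhostState Var V HF}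
    (hw : w ∈ monotonize P) (hge : Ge w' w) :
    ∃ v, F.evalBE b w' = some v ∧ w ∈ monotonize (P ∩ {w | F.evalBE b w = some v}) := by
  obtain ⟨w₀, h, h₀⟩ := hw
  obtain ⟨v, hv⟩ := Option.isSome_iff_exists.1 (hP w₀ h₀)
  exact ⟨v, hF.evalBE_mono _ _ _ _ (hge.trans h) hv, w₀, h, h₀, hv⟩

theorem Valid.prim (hF : F.Requirements Δ) {P Q : Set (GhostState Var V HF)} {c : C}
    (hc : F.wfPrim Δ c) (h : F.cslPrim Δ P c Q) : F.Valid Δ P (.prim c) Q := by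
  intro n s h₀ _ hst hmem
  cases n with
  | zero => trivial
  | succ n =>
    have ha := hF.cslPrim_affine _ _ _ h
    refine ⟨nofun, fun hp hf ht hfst ho => ?_⟩
    have ho' : oplus (⟨s, h₀⟩ : GhostState Var V HF) ⟨s, hf⟩ = some (F.embed ⟨s, hp⟩) :=
      (GhostState.oplus_eq_some _ _ _).2 ⟨rfl, rfl, ho⟩
    refine ⟨fun | .prim hn => hn (hF.cslPrim_progress _ _ _ hc ha (monotone_monotonize P)
      _ _ _ ht ho' hmem hst hfst), fun c' σ' hr => ?_⟩
    cases hr with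
    | prim hr =>
      obtain ⟨w', wf', hheap, hst', hsum, hQ⟩ := hF.cslPrim_post _ _ _ hc ha
        (monotone_monotonize P) (monotone_monotonize Q) _ _ _ _ ht ho' hmem hst hfst hr
      obtain ⟨h₁, -, h₃⟩ := (GhostState.oplus_eq_some _ _ _).1 hsum
      refine ⟨w'.heap, hst', ?_, safe_skip ?_ n⟩
      -- The new frame may differ from the old one in its store, but its heap is still `hf`.
      · rw [show hf = wf'.heap from hheap]
        exact h₃
      · rw [show σ'.store = w'.store from h₁.symm]
        exact hQ

theorem Valid.cond (hF : F.Requirements Δ) {P Q₁ Q₂ : Set (GhostState Var V HF)} {b : BE}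
    {c₁ c₂ : Stmt Var T BE A C} (hb : Frames P (F.evalBE b))
    (h₁ : F.Valid Δ (P ∩ {w | F.evalBE b w = some true}) c₁ Q₁)
    (h₂ : F.Valid Δ (P ∩ {w | F.evalBE b w = some false}) c₂ Q₂) :
    F.Valid Δ P (.cond b c₁ c₂) (Q₁ ∪ Q₂) := by
  intro n s h hs hst hmem
  cases n with
  | zero => trivial
  | succ n =>
    refine ⟨nofun, fun hp hf ht hfst ho => ?_⟩
    obtain ⟨v, hv, hmem'⟩ := hF.mem_monotonize_inter hb hmem (embed_ge ho)
    refine ⟨?_, fun c' σ' hr => ?_⟩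
    · rintro (_ | _ | hn)
      rw [hn] at hv
      cases hv
    · cases hr with
      | condT hr =>
        obtain rfl : v = true := Option.some_inj.1 (hv.symm.trans hr)
        exact ⟨h, hst, ho, (h₁ n s h hs hst hmem').mono (monotonize_mono Set.subset_union_left)⟩
      | condF hr =>
        obtain rfl : v = false := Option.some_inj.1 (hv.symm.trans hr)
        exact ⟨h, hst, ho, (h₂ n s h hs hst hmem').mono (monotonize_mono Set.subset_union_right)⟩

theorem Valid.loop (hF : F.Requirements Δ) {P : Set (GhostState Var V HF)} {b : BE}
    {I : Assn Var T BE A} {c : Stmt Var T BE A C} (hb : Frames P (F.evalBE b))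
    (hc : F.Valid Δ (P ∩ {w | F.evalBE b w = some true}) c P) :
    F.Valid Δ P (.loop b I c) (P ∩ {w | F.evalBE b w = some false}) := by
  intro n
  induction n using Nat.strong_induction_on with
  | _ n ih =>
    intro s h hs hst hmem
    match n with
    | 0 => trivial
    | 1 =>
      exact ⟨nofun, fun hp hf ht hfst ho => ⟨nofun, fun | _, _, .loop => ⟨h, hst, ho, trivial⟩⟩⟩
    | n + 2 =>
      -- One index is spent on unfolding the loop and one on the conditional, leaving `n` for `c`
      -- followed by the loop.
      refine ⟨nofun, fun hp hf ht hfst ho => ⟨nofun, fun | _, _, .loop => ⟨h, hst, ho, ?_⟩⟩⟩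
      refine ⟨nofun, fun hp hf ht hfst ho => ?_⟩
      obtain ⟨v, hv, hmem'⟩ := hF.mem_monotonize_inter hb hmem (embed_ge ho)
      refine ⟨?_, fun c' σ' hr => ?_⟩
      · rintro (_ | _ | hn)
        rw [hn] at hv
        cases hv
      · cases hr with
        | condT hr =>
          obtain rfl : v = true := Option.some_inj.1 (hv.symm.trans hr)
          exact ⟨h, hst, ho, (hc n s h hs hst hmem').seq hst fun m hm => ih m (by omega)⟩
        | condF hr =>
          obtain rfl : v = false := Option.some_inj.1 (hv.symm.trans hr)
          exact ⟨h, hst, ho, safe_skip hmem' n⟩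

/-- For a conditional, `b` is defined on `P`, so `P` is the union of the two branch preconditions.
For a loop, `P` is the postcondition of the body, and stability of `b` keeps `¬b` true under
stabilization. -/
theorem CSL.stabClosed {P Q : Set (GhostState Var V HF)} {c : Stmt Var T BE A C}
    (h : F.CSL Δ P c Q) : StabClosed P ∧ StabClosed Q := by
  induction h with
  | skip h => exact ⟨h.stabClosed, h.stabClosed⟩
  | prim hP hQ _ => exact ⟨hP.stabClosed, hQ.stabClosed⟩
  | seq _ _ ih₁ ih₂ => exact ⟨ih₁.1, ih₂.2⟩
  | cond hb _ _ ih₁ ih₂ =>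
    refine ⟨fun w hw => ?_, ih₁.2.union ih₂.2⟩
    obtain ⟨v, hv⟩ := Option.isSome_iff_exists.1 (hb w hw)
    cases v with
    | true => exact (ih₁.1 w ⟨hw, hv⟩).1
    | false => exact (ih₂.1 w ⟨hw, hv⟩).1
  | loop _ hb _ ih => exact ⟨ih.2, fun w hw => ⟨ih.2 w hw.1, (hb w hw.1).symm.trans hw.2⟩⟩
  | par _ _ _ _ _ _ ih₁ ih₂ => exact ⟨ih₁.1.sepConj ih₂.1, ih₁.2.sepConj ih₂.2⟩
  | frame _ hR _ ih => exact ⟨ih.1.sepConj hR.stabClosed, ih.2.sepConj hR.stabClosed⟩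
  | conseq _ _ _ hP hQ _ => exact ⟨hP.stabClosed, hQ.stabClosed⟩

theorem CSL.valid (hF : F.Requirements Δ) {P Q : Set (GhostState Var V HF)}
    {c : Stmt Var T BE A C} (h : F.CSL Δ P c Q) (hc : F.PrimWF Δ c) : F.Valid Δ P c Q := by
  induction h with
  | skip _ => exact fun n s h _ _ hmem => safe_skip hmem n
  | prim _ _ h => exact Valid.prim hF hc h
  | seq _ _ ih₁ ih₂ =>
    exact fun n s h hs hst hmem => (ih₁ hc.1 n s h hs hst hmem).seq hst fun m _ => ih₂ hc.2 m
  | cond hb _ _ ih₁ ih₂ => exact Valid.cond hF hb (ih₁ hc.1) (ih₂ hc.2)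
  | loop hb _ _ ih => exact Valid.loop hF hb (ih hc)
  | par d₁ d₂ hd₁ hd₂ hi₁ hi₂ ih₁ ih₂ =>
    intro n s h hs hst hmem
    obtain ⟨h₁, h₂, m₁, m₂, st₁, st₂, ho⟩ :=
      exists_stable_heap_split d₁.stabClosed.1 d₂.stabClosed.1 hst hmem
    exact Safe.mono (sepConj_monotonize_subset _ _)
      (Safe.par hF (ih₁ hc.1 n s h₁ hs st₁ m₁) (ih₂ hc.2 n s h₂ hs st₂ m₂) hc.1 hc.2
        (Set.disjoint_iff_inter_eq_empty.2 hd₁) (Set.disjoint_iff_inter_eq_empty.2 hd₂)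
        (fun x hx => (hi₁ x hx).2.updClosed.monotonize)
        (fun x hx => (hi₂ x hx).2.updClosed.monotonize) st₁ st₂ ho)
  | frame d hR hi ih =>
    intro n s h hs hst hmem
    obtain ⟨h₁, h₂, m₁, m₂, st₁, st₂, ho⟩ :=
      exists_stable_heap_split d.stabClosed.1 hR.stabClosed hst hmem
    exact Safe.mono (sepConj_monotonize_subset _ _)
      (Safe.frame hF (ih hc n s h₁ hs st₁ m₁) hc st₂
        (fun x hx => (hi x hx).updClosed.monotonize) m₂ ho)
  | conseq _ hP hQ _ _ ih =>
    exact fun n s h hs hst hmem =>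
      (ih hc n s h hs hst (monotonize_mono hP hmem)).mono (monotonize_mono hQ)

/-! ### Soundness of whole executions -/

/-- The owned heap may depend on the index `n`, so no single heap has to be safe for all `n`; each
step uses the assumption at `n + 1`. -/
theorem Safe.redStar (hF : F.Requirements Δ) {hf : HF} (hfst : stable hf)
    {Q : Set (GhostState Var V HF)} {c c' : Stmt Var T BE A C} {σ σ' : ProgState Var V HP}
    (hr : F.RedStar Δ c σ c' σ') (hc : F.PrimWF Δ c) (hσ : F.WellTyped Δ σ)
    (hs : ∀ n, ∃ h, oplus h hf = some (F.embedHeap σ.heap) ∧ F.Safe Δ n c σ.store h Q) :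
    F.WellTyped Δ σ' ∧
      ∀ n, ∃ h, oplus h hf = some (F.embedHeap σ'.heap) ∧ F.Safe Δ n c' σ'.store h Q := by
  have key : ∀ p q : Stmt Var T BE A C × ProgState Var V HP,
      Relation.ReflTransGen (fun p q => F.Red Δ p.1 p.2 q.1 q.2) p q →
      F.PrimWF Δ p.1 ∧ F.WellTyped Δ p.2 ∧ (∀ n, ∃ h,
        oplus h hf = some (F.embedHeap p.2.heap) ∧ F.Safe Δ n p.1 p.2.store h Q) →
      F.PrimWF Δ q.1 ∧ F.WellTyped Δ q.2 ∧ (∀ n, ∃ h,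
        oplus h hf = some (F.embedHeap q.2.heap) ∧ F.Safe Δ n q.1 q.2.store h Q) := by
    intro p q hpq hp
    induction hpq with
    | refl => exact hp
    | tail _ hstep ih =>
      obtain ⟨hc, hσ, hs⟩ := ih
      refine ⟨hstep.primWF hc, hstep.wellTyped hF hc hσ, fun n => ?_⟩
      obtain ⟨h, ho, hsafe⟩ := hs (n + 1)
      obtain ⟨h', -, ho', hsafe'⟩ := (hsafe.2 _ hf hσ hfst ho).2 _ _ hstep
      exact ⟨h', ho', hsafe'⟩
  exact (key _ _ hr ⟨hc, hσ, hs⟩).2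

end FrontEnd

end FrontEndCSL

theorem theoremA {Var : Type uX} {T : Type uT} {V : Type uV} {HF : Type uG} {HP : Type uP}
    {BE : Type uB} {A : Type uA} {C : Type uC} {D : Type uD} [DecidableEq Var]
    [FrontEndCSL.IDFAlgebra HF]
    (F : FrontEndCSL.FrontEnd Var T V HF HP BE A C D) (Δ : FrontEndCSL.TypeContext Var T D)
    (hF : F.Requirements Δ)
    (P Q : Set (FrontEndCSL.GhostState Var V HF)) (c : FrontEndCSL.Stmt Var T BE A C)
    (hcsl : F.CSL Δ P c Q) (hwf : F.WF Δ c)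
    (hP : FrontEndCSL.Monotone P) (hQ : FrontEndCSL.Monotone Q)
    (σ : FrontEndCSL.ProgState Var V HP) (hσ : F.WellTyped Δ σ)
    (hstable : FrontEndCSL.IDFAlgebra.stable (F.embed σ)) (hpre : F.embed σ ∈ P) :
    F.NeverAborts Δ c σ ∧
      ∀ σ', F.RedStar Δ c σ .skip σ' → F.embed σ' ∈ Q := by
  have hc := FrontEndCSL.FrontEnd.WF.primWF hwf
  -- The initial owned heap is all of the embedded heap; its unit serves as the stable frame
  -- throughout.
  have hsafe : ∀ n, ∃ h, FrontEndCSL.IDFAlgebra.oplus h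
      (FrontEndCSL.IDFAlgebra.unit (F.embedHeap σ.heap)) = some (F.embedHeap σ.heap) ∧
      F.Safe Δ n c σ.store h (FrontEndCSL.monotonize Q) := fun n =>
    ⟨_, FrontEndCSL.IDFAlgebra.oplus_unit _, hcsl.valid hF hc n _ _ hσ.1 hstable
      (FrontEndCSL.subset_monotonize P hpre)⟩
  have hu := FrontEndCSL.IDFAlgebra.stable_unit (F.embedHeap σ.heap)
  refine ⟨fun c' σ' hr => ?_, fun σ' hr => ?_⟩
  · obtain ⟨ht, hs⟩ := FrontEndCSL.FrontEnd.Safe.redStar hF hu hr hc hσ hsafe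
    -- Index 1 suffices: abort-freedom and the postcondition of `skip` are read off the current
    -- configuration.
    obtain ⟨h, ho, hs⟩ := hs 1
    exact (hs.2 _ _ ht hu ho).1
  · obtain ⟨ht, hs⟩ := FrontEndCSL.FrontEnd.Safe.redStar hF hu hr hc hσ hsafe
    obtain ⟨h, ho, hs⟩ := hs 1
    -- Monotonicity of `Q` is used twice: to drop the closure, and to pass from the owned part to
    -- the full state.
    exact hQ _ (hQ.monotonize_subset (hs.1 rfl)) _ (FrontEndCSL.FrontEnd.embed_ge ho)
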